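/- Write $\langle y\rangle=(1+y^2)^{1/2}$ and let $\widehat f(\xi,\tau)=(2\pi)^{-1}\int\!\!\int e^{-i(x\xi+t\tau)}f(x,t)\,dx\,dt$ be the space-time Fourier transform on $\mathbb R_x\times\mathbb R_t$. For a real function $\varphi$ on $\mathbb R$ and $m,b\in\mathbb R$ let $X_\varphi^{m,b}$ be the completion of the Schwartz space $\mathcal S(\mathbb R\times\mathbb R)$ (realised inside the tempered distributions) with respect to $$\|f\|_{X_\varphi^{m,b}}=\big\|\langle\xi\rangle^m\langle\tau+\varphi(\xi)\rangle^b\,\widehat f(\xi,\tau)\big\|_{L^2_{\xi\tau}} .$$ Put $X^{m,b}=X_\varphi^{m,b}$ for $\varphi(\xi)=|\xi|^2$ and $X_\pm^{m,b}=X_\varphi^{m,b}$ for $\varphi(\xi)=\pm|\xi|$, and let $D_x^{1/2}$ be the Fourier multiplier with symbol $|\xi|^{1/2}$. **Lemma 2.3.** For every $\varepsilon>0$ there is a constant $c=c(\varepsilon)$ such that, for either sign, for all $u\in X^{\varepsilon,1/2}$ and all $n_\pm\in X_\pm^{0,1/2}$, the distributions $D_x^{1/2}u$ and $n_\pm$ are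 functions, their product belongs to $L^2_tL^2_x(\mathbb R\times\mathbb R)$, and $$\|(D_x^{1/2}u)\,n_\pm\|_{L^2_tL^2_x}\le c\,\|n_\pm\|_{X_\pm^{0,1/2}}\,\|u\|_{X^{\varepsilon,1/2}} .$$ -/

import Mathlib

open MeasureTheory Filter
open scoped SchwartzMap FourierTransform ENNReal NNReal Topology

namespace Zakharov

/-- Space-time `ℝ × ℝ` with its Euclidean structure: a point `z` has the space coordinate
`x = z 0` and the time coordinate `t = z 1`. The dual (frequency) plane is the same type, with
`0` for the space frequency and `1` for the time frequency. -/
abbrev Plane : Type := EuclideanSpace ℝ (Fin 2)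

/-- The tempered distribution `f` is (integration against) the measurable function `g`. Such a
`g` is unique up to a null set. -/
def IsFunction (f : 𝓢'(Plane, ℂ)) (g : Plane → ℂ) : Prop :=
  AEStronglyMeasurable g volume ∧
    ∀ ψ : 𝓢(Plane, ℂ), Integrable (fun z => ψ z * g z) volume ∧ f ψ = ∫ z, ψ z * g z

/-- The angular space frequency `ξ = 2π ζ₀`. Mathlib's Fourier transform has the kernel
`exp (-2πi ⟨z, ζ⟩)`, so `∂ₓ` is multiplication by `i ξ` on the Fourier side. -/
noncomputable def freqX (ζ : Plane) : ℝ := 2 * Real.pi * ζ 0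

/-- The angular time frequency `τ = 2π ζ₁`; `∂ₜ` is multiplication by `i τ`. -/
noncomputable def freqT (ζ : Plane) : ℝ := 2 * Real.pi * ζ 1

/-- The bracket `⟨y⟩ = (1 + y²)^{1/2}`. -/
noncomputable def bracket (y : ℝ) : ℝ := Real.sqrt (1 + y ^ 2)

/-- The weight `⟨ξ⟩^m ⟨τ + φ(ξ)⟩^b`. -/
noncomputable def weight (φ : ℝ → ℝ) (m b : ℝ) (ζ : Plane) : ℝ :=
  bracket (freqX ζ) ^ m * bracket (freqT ζ + φ (freqX ζ)) ^ b

/-- The norm `‖f‖_{X_φ^{m,b}} = ‖⟨ξ⟩^m ⟨τ + φ(ξ)⟩^b f̂(ξ,τ)‖_{L²}`, with value `∞` if the Fourier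
transform of `f` is not a function. The infimum is over the representatives `g` of the Fourier
transform, which all give the same value. The change of variables
`(ξ, τ) = 2π ζ` makes this the norm for the unitarily normalised
`f̂(ξ,τ) = (2π)⁻¹ ∫∫ exp(-i(xξ + tτ)) f(x,t) dx dt`. -/
noncomputable def xNorm (φ : ℝ → ℝ) (m b : ℝ) (f : 𝓢'(Plane, ℂ)) : ℝ≥0∞ :=
  ⨅ (g : Plane → ℂ) (_ : IsFunction (𝓕 f) g),
    eLpNorm (fun ζ => (weight φ m b ζ : ℂ) * g ζ) 2 volume

/-- Membership in `X_φ^{m,b}`, the completion of the Schwartz space under `xNorm φ m b`, realised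
inside the tempered distributions: `f` has finite norm and is the limit in this norm of a
sequence of Schwartz functions. -/
def MemX (φ : ℝ → ℝ) (m b : ℝ) (f : 𝓢'(Plane, ℂ)) : Prop :=
  xNorm φ m b f < ∞ ∧
    ∃ s : ℕ → 𝓢(Plane, ℂ),
      Tendsto (fun k => xNorm φ m b ((s k : 𝓢'(Plane, ℂ)) - f)) atTop (𝓝 0)

/-- The Schrödinger phase `φ(ξ) = |ξ|²`, which gives the space `X^{m,b}`. -/
def phaseS (ξ : ℝ) : ℝ := |ξ| ^ 2

/-- The half-wave phases `φ(ξ) = ±|ξ|` for a sign `σ`, which give the spaces `X_±^{m,b}`. -/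
def phaseW (σ : ℤˣ) (ξ : ℝ) : ℝ := ((σ : ℤ) : ℝ) * |ξ|

/-- `w = D_x^s u`: the Fourier transform of `u` is a function `û`, and that of `w` is `|ξ|^s û`. -/
def IsDx (s : ℝ) (u w : 𝓢'(Plane, ℂ)) : Prop :=
  ∃ g : Plane → ℂ, IsFunction (𝓕 u) g ∧
    IsFunction (𝓕 w) (fun ζ => ((|freqX ζ| ^ s : ℝ) : ℂ) * g ζ)

end Zakharov

/-!
The estimate is proved on the Fourier side. Write `û = F / (⟨ξ⟩^ε ⟨τ + ξ²⟩^{1/2})` and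
`n̂ = G / ⟨τ ± |ξ|⟩^{1/2}` with `F, G ∈ L²`. The Fourier transform of the product is a convolution,
and Cauchy–Schwarz in its inner variable (`lintegral_sq_convolution_le`) reduces the bound to

  `sup_{ξ,τ} ∫∫ |x| ⟨x⟩^{-2ε} ⟨t + x²⟩⁻¹ ⟨τ - t ± |ξ - x|⟩⁻¹ dt dx < ∞`,

which is `exists_lintegral_kernel_le`. The two brackets containing `t` have arguments with the sum
`h(x) = τ + x² ± |ξ - x|`, independent of `t`, so the integral in `t` is `O(⟨h⟩^{-1+δ})`, with
`⟨h⟩^δ` in place of a logarithm. The factor `⟨x⟩^{-2ε}` pays for this loss: where `⟨h⟩ ≤ ⟨x⟩²` it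
turns `⟨h⟩^{-1+δ}` into `⟨h⟩^{-1-δ}`, and elsewhere `|x| ⟨x⟩^{-2ε} ⟨h⟩^{-1+δ} ≤ ⟨x⟩^{-1-δ}` is
integrable. Finally `∫ |x| ⟨h(x)⟩^{-1-δ} dx` is bounded since `h` is one of two quadratic
polynomials at every point and `|x|` is dominated by their derivatives when `|x| ≥ 1`; the factor
`|x|`, that is, the half derivative, is the Jacobian.

There remains the passage from integrable Fourier transforms
(`exists_eLpNorm_fourierInv_mul_le`) to general `u` and `n`. For small `ε` the transform
`|ξ|^{1/2} û` need not be square integrable, so that `D_x^{1/2} u` is a function at all is a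
smoothing effect, and it follows from the bilinear estimate itself: with a Schwartz function `ψ` in
the place of `n`, it shows that the products with `ψ` of the frequency truncations of `D_x^{1/2} u`
form a Cauchy sequence in `L²`. Their almost everywhere limit `v`
(`exists_ae_tendsto_halfDerivApprox`) represents `D_x^{1/2} u`
(`integrable_and_integral_mul_limit`), and Fatou's lemma carries the estimate over to the limit.
-/

namespace Zakharov

/-! ### One-dimensional integrals of the bracket -/

theorem one_le_bracket (y : ℝ) : 1 ≤ bracket y :=
  Real.one_le_sqrt.2 (by nlinarith [sq_nonneg y])

theorem bracket_pos (y : ℝ) : 0 < bracket y := one_pos.trans_le (one_le_bracket y)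

theorem continuous_bracket : Continuous bracket := by
  unfold bracket; fun_prop

theorem sq_bracket (y : ℝ) : bracket y ^ 2 = 1 + y ^ 2 :=
  Real.sq_sqrt (by positivity)

theorem abs_le_bracket (y : ℝ) : |y| ≤ bracket y :=
  Real.abs_le_sqrt (by linarith)

theorem bracket_le_one_add_abs (y : ℝ) : bracket y ≤ 1 + |y| := by
  refine Real.sqrt_le_iff.2 ⟨by positivity, ?_⟩
  nlinarith [sq_abs y, abs_nonneg y]

theorem bracket_add_le (x y : ℝ) : bracket (x + y) ≤ bracket x + bracket y := by
  refine Real.sqrt_le_iff.2 ⟨(add_pos (bracket_pos x) (bracket_pos y)).le, ?_⟩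
  have h : x * y ≤ bracket x * bracket y := by
    calc x * y ≤ |x| * |y| := by rw [← abs_mul]; exact le_abs_self _
      _ ≤ _ := mul_le_mul (abs_le_bracket x) (abs_le_bracket y) (abs_nonneg y) (bracket_pos x).le
  nlinarith [sq_bracket x, sq_bracket y]

/-- The integral `∫ ⟨y⟩^{-1-δ} dy`. -/
noncomputable def bracketIntegral (δ : ℝ) : ℝ≥0∞ :=
  ∫⁻ y : ℝ, ENNReal.ofReal (bracket y ^ (-(1 + δ)))

theorem measurable_ofReal_bracket_rpow (r : ℝ) :
    Measurable fun y => ENNReal.ofReal (bracket y ^ r) :=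
  (continuous_bracket.measurable.pow_const r).ennreal_ofReal

theorem bracketIntegral_lt_top {δ : ℝ} (hδ : 0 < δ) : bracketIntegral δ < ∞ := by
  have h := integrable_rpow_neg_one_add_norm_sq (E := ℝ) (μ := volume) (r := 1 + δ)
    (by simp [hδ])
  refine lt_of_le_of_lt (lintegral_mono fun y => ?_) h.lintegral_lt_top
  refine ENNReal.ofReal_le_ofReal (le_of_eq ?_)
  rw [bracket, Real.sqrt_eq_rpow, ← Real.rpow_mul (by positivity), Real.norm_eq_abs, sq_abs]
  congr 1; ring

/-- On `s = [1, ∞)` or `s = (-∞, -1]` the quadratic polynomial `x² + a x + b`, `a = ±1`, is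
injective and its derivative dominates `|x|`, so that `|x| dx` is controlled by the measure of
its values. -/
theorem setLIntegral_abs_mul_comp_quadratic_le {s : Set ℝ} (hs : MeasurableSet s)
    (hs' : (∀ x ∈ s, 1 ≤ x) ∨ ∀ x ∈ s, x ≤ -1) {a : ℝ} (ha : a = 1 ∨ a = -1) (b : ℝ)
    (g : ℝ → ℝ≥0∞) :
    ∫⁻ x in s, ENNReal.ofReal |x| * g (x ^ 2 + a * x + b) ≤ ∫⁻ y, g y := by
  have hd : ∀ x ∈ s, HasDerivWithinAt (fun x : ℝ => x ^ 2 + a * x + b) (2 * x + a) s x := by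
    intro x _
    have := (((hasDerivAt_id x).pow 2).add ((hasDerivAt_id x).const_mul a)).add_const b
    simpa using this.hasDerivWithinAt
  have hinj : Set.InjOn (fun x : ℝ => x ^ 2 + a * x + b) s := by
    intro x hx y hy hxy
    have h : (x - y) * (x + y + a) = 0 := by
      simp only at hxy; linear_combination hxy
    rcases mul_eq_zero.1 h with h | h
    · linarith
    · exfalso
      rcases hs' with hs' | hs' <;> rcases ha with rfl | rfl <;> linarith [hs' x hx, hs' y hy]
  calc _ ≤ ∫⁻ x in s, ENNReal.ofReal |2 * x + a| * g (x ^ 2 + a * x + b) := by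
        refine setLIntegral_mono' hs fun x hx => ?_
        refine mul_le_mul' (ENNReal.ofReal_le_ofReal ?_) le_rfl
        rcases hs' with hs' | hs' <;> rcases ha with rfl | rfl <;> have := hs' x hx <;>
          rcases abs_cases x with ⟨h, _⟩ | ⟨h, _⟩ <;> rw [h] <;> rw [le_abs] <;>
          first | (left; linarith) | (right; linarith)
    _ = ∫⁻ y in (fun x : ℝ => x ^ 2 + a * x + b) '' s, g y :=
        (lintegral_image_eq_lintegral_abs_deriv_mul hs hd hinj g).symm
    _ ≤ _ := setLIntegral_le_lintegral _ _

theorem lintegral_abs_mul_bracket_quadratic_le {δ : ℝ} (hδ : 0 < δ) {a : ℝ} (ha : a = 1 ∨ a = -1)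
    (b : ℝ) :
    ∫⁻ x : ℝ, ENNReal.ofReal |x| * ENNReal.ofReal (bracket (x ^ 2 + a * x + b) ^ (-(1 + δ)))
      ≤ 2 + (bracketIntegral δ + bracketIntegral δ) := by
  have hU : (Set.univ : Set ℝ) ⊆ Set.Icc (-1) 1 ∪ (Set.Ici 1 ∪ Set.Iic (-1)) := by
    intro x _
    simp only [Set.mem_union, Set.mem_Icc, Set.mem_Ici, Set.mem_Iic]
    rcases le_total x (-1) with h | h
    · exact .inr (.inr h)
    · rcases le_total x 1 with h' | h'
      · exact .inl ⟨h, h'⟩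
      · exact .inr (.inl h')
  rw [← setLIntegral_univ]
  refine (lintegral_mono_set hU).trans ((lintegral_union_le _ _ _).trans
    (add_le_add ?_ ((lintegral_union_le _ _ _).trans (add_le_add ?_ ?_))))
  · calc _ ≤ ∫⁻ x in Set.Icc (-1 : ℝ) 1, 1 := by
          refine setLIntegral_mono' measurableSet_Icc fun x hx => ?_
          refine mul_le_one' (ENNReal.ofReal_le_one.2 (abs_le.2 hx))
            (ENNReal.ofReal_le_one.2 ?_)
          exact Real.rpow_le_one_of_one_le_of_nonpos (one_le_bracket _) (by linarith)
      _ ≤ 2 := by simp; norm_num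
  · exact setLIntegral_abs_mul_comp_quadratic_le measurableSet_Ici (.inl fun x hx => hx) ha b
      fun y => ENNReal.ofReal (bracket y ^ (-(1 + δ)))
  · exact setLIntegral_abs_mul_comp_quadratic_le measurableSet_Iic (.inr fun x hx => hx) ha b
      fun y => ENNReal.ofReal (bracket y ^ (-(1 + δ)))

/-! ### The kernel of the bilinear estimate -/

/-- Splitting `⟨x + y⟩` between the two factors trades a small power of it for the integrability
of `⟨x⟩⁻¹ ⟨y⟩⁻¹` along lines of constant `x + y`. -/
theorem inv_bracket_mul_inv_bracket_le {δ : ℝ} (hδ : 0 < δ) (hδ1 : δ ≤ 1) (x y : ℝ) :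
    (bracket x)⁻¹ * (bracket y)⁻¹ ≤
      bracket (x + y) ^ (-(1 - δ)) *
        (2 * (bracket x ^ (-(1 + δ)) + bracket y ^ (-(1 + δ)))) := by
  have hX := bracket_pos x
  have hY := bracket_pos y
  have hH := bracket_pos (x + y)
  set X := bracket x
  set Y := bracket y
  set H := bracket (x + y)
  rw [Real.rpow_neg hH.le, le_inv_mul_iff₀ (by positivity), mul_comm (H ^ (1 - δ))]
  -- by symmetry the larger of the two brackets may absorb the power of `⟨x + y⟩`
  have key : ∀ {A B : ℝ}, 0 < A → 0 < B → A ≤ B → H ≤ A + B →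
      A⁻¹ * B⁻¹ * H ^ (1 - δ) ≤ 2 * A ^ (-(1 + δ)) := by
    intro A B hA hB hAB hHA
    have h1 : H ^ (1 - δ) ≤ (2 * B) ^ (1 - δ) :=
      Real.rpow_le_rpow hH.le (by linarith) (by linarith)
    have h2 : (2 * B) ^ (1 - δ) ≤ 2 * B ^ (1 - δ) := by
      rw [Real.mul_rpow (by norm_num) hB.le]
      refine mul_le_mul_of_nonneg_right ?_ (by positivity)
      calc (2 : ℝ) ^ (1 - δ) ≤ 2 ^ (1 : ℝ) :=
            Real.rpow_le_rpow_of_exponent_le (by norm_num) (by linarith)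
        _ = 2 := by simp
    calc A⁻¹ * B⁻¹ * H ^ (1 - δ) ≤ A⁻¹ * B⁻¹ * (2 * B ^ (1 - δ)) := by
          gcongr; exact h1.trans h2
      _ = 2 * (A⁻¹ * B ^ (-δ)) := by
          have : B ^ (-δ) = B⁻¹ * B ^ (1 - δ) := by
            rw [← Real.rpow_neg_one B, ← Real.rpow_add hB]; congr 1; ring
          rw [this]; ring
      _ ≤ 2 * (A⁻¹ * A ^ (-δ)) := by
          have : B ^ (-δ) ≤ A ^ (-δ) := Real.rpow_le_rpow_of_nonpos hA hAB (by linarith)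
          gcongr
      _ = 2 * A ^ (-(1 + δ)) := by
          rw [← Real.rpow_neg_one A, ← Real.rpow_add hA]; congr 2; ring
  have hadd : H ≤ X + Y := bracket_add_le x y
  have hX' : 0 < X ^ (-(1 + δ)) := by positivity
  have hY' : 0 < Y ^ (-(1 + δ)) := by positivity
  rcases le_total X Y with h | h
  · linarith [key hX hY h hadd]
  · have := key hY hX h (by linarith)
    rw [mul_comm Y⁻¹] at this
    linarith

/-- The gain `⟨x⟩^{-2ε}` absorbs the loss `⟨h⟩^δ` when `⟨h⟩ ≤ ⟨x⟩²`, and otherwise `⟨h⟩` is large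
enough for decay in `x` alone. -/
theorem abs_mul_bracket_rpow_mul_bracket_rpow_le {ε δ : ℝ} (hδ : 0 < δ) (hδ1 : δ ≤ 1)
    (hδε : 2 * δ ≤ ε) (x h : ℝ) :
    |x| * bracket x ^ (-(2 * ε)) * bracket h ^ (-(1 - δ)) ≤
      |x| * bracket h ^ (-(1 + δ)) + bracket x ^ (-(1 + δ)) := by
  have hX := bracket_pos x
  have hH := bracket_pos h
  have hX1 := one_le_bracket x
  have hxX := abs_le_bracket x
  set X := bracket x
  set H := bracket h
  rcases le_total H (X ^ 2) with hle | hle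
  · have h1 : X ^ (-(2 * ε)) ≤ H ^ (-(2 * δ)) := by
      rw [Real.rpow_neg hX.le, Real.rpow_neg hH.le]
      gcongr
      calc H ^ (2 * δ) ≤ (X ^ 2) ^ (2 * δ) := Real.rpow_le_rpow hH.le hle (by linarith)
        _ = X ^ (2 * (2 * δ)) := by
          rw [← Real.rpow_natCast X 2, ← Real.rpow_mul hX.le]; norm_num
        _ ≤ X ^ (2 * ε) := Real.rpow_le_rpow_of_exponent_le hX1 (by linarith)
    calc _ ≤ |x| * H ^ (-(2 * δ)) * H ^ (-(1 - δ)) := by gcongr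
      _ = |x| * H ^ (-(1 + δ)) := by
          rw [mul_assoc, ← Real.rpow_add hH]; congr 2; ring
      _ ≤ _ := le_add_of_nonneg_right (by positivity)
  · have h1 : H ^ (-(1 - δ)) ≤ X ^ (-(2 * (1 - δ))) := by
      calc H ^ (-(1 - δ)) ≤ (X ^ 2) ^ (-(1 - δ)) :=
            Real.rpow_le_rpow_of_nonpos (by positivity) hle (by linarith)
        _ = X ^ (-(2 * (1 - δ))) := by
          rw [← Real.rpow_natCast X 2, ← Real.rpow_mul hX.le]; congr 1; push_cast; ring
    calc _ ≤ X ^ (1 : ℝ) * X ^ (-(2 * ε)) * X ^ (-(2 * (1 - δ))) := by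
          rw [Real.rpow_one]; gcongr
      _ = X ^ (1 + -(2 * ε) + -(2 * (1 - δ))) := by
          rw [← Real.rpow_add hX, ← Real.rpow_add hX]
      _ ≤ X ^ (-(1 + δ)) := Real.rpow_le_rpow_of_exponent_le hX1 (by linarith)
      _ ≤ _ := le_add_of_nonneg_left (by positivity)

theorem units_int_cast_eq (σ : ℤˣ) : (((σ : ℤ) : ℝ) = 1) ∨ (((σ : ℤ) : ℝ) = -1) := by
  rcases Int.units_eq_one_or σ with rfl | rfl <;> simp

/-- The kernel that Cauchy–Schwarz leaves behind has an integral that is bounded uniformly in the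
output frequency `(ξ, τ)` and in the sign. -/
theorem exists_lintegral_kernel_le {ε : ℝ} (hε : 0 < ε) :
    ∃ K : ℝ≥0∞, K < ∞ ∧ ∀ (σ : ℤˣ) (ξ τ : ℝ),
      ∫⁻ x : ℝ, ∫⁻ t : ℝ, ENNReal.ofReal (|x| * bracket x ^ (-(2 * ε)) *
        ((bracket (t + phaseS x))⁻¹ * (bracket (τ - t + phaseW σ (ξ - x)))⁻¹)) ≤ K := by
  set δ : ℝ := min (ε / 2) 1
  have hδ : 0 < δ := lt_min (by linarith) one_pos
  have hδ1 : δ ≤ 1 := min_le_right _ _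
  have hδε : 2 * δ ≤ ε := by linarith [min_le_left (ε / 2) 1]
  set J := bracketIntegral δ
  have hJ : J < ∞ := bracketIntegral_lt_top hδ
  refine ⟨((2 + (J + J)) + (2 + (J + J)) + J) * (2 * (J + J)), ?_, fun σ ξ τ => ?_⟩
  · refine ENNReal.mul_lt_top ?_ ?_ <;> simp [ENNReal.mul_lt_top_iff, hJ]
  set e : ℝ → ℝ≥0∞ := fun y => ENNReal.ofReal (bracket y ^ (-(1 + δ))) with he
  have hem : Measurable e := measurable_ofReal_bracket_rpow _
  have hpow : ∀ (y r : ℝ), 0 ≤ bracket y ^ r := fun y r => Real.rpow_nonneg (bracket_pos y).le r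
  -- the resonance function does not depend on the inner variable
  have inner_le : ∀ x : ℝ, ∫⁻ t : ℝ, ENNReal.ofReal (|x| * bracket x ^ (-(2 * ε)) *
        ((bracket (t + phaseS x))⁻¹ * (bracket (τ - t + phaseW σ (ξ - x)))⁻¹)) ≤
      (ENNReal.ofReal |x| * e (x ^ 2 + -1 * x + (τ + ξ)) +
        ENNReal.ofReal |x| * e (x ^ 2 + 1 * x + (τ - ξ)) + e x) * (2 * (J + J)) := by
    intro x
    set h := τ + phaseS x + phaseW σ (ξ - x) with hh
    have hA : ENNReal.ofReal (|x| * bracket x ^ (-(2 * ε)) * bracket h ^ (-(1 - δ))) ≤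
        ENNReal.ofReal |x| * e (x ^ 2 + -1 * x + (τ + ξ)) +
        ENNReal.ofReal |x| * e (x ^ 2 + 1 * x + (τ - ξ)) + e x := by
      refine (ENNReal.ofReal_le_ofReal
        (abs_mul_bracket_rpow_mul_bracket_rpow_le hδ hδ1 hδε x h)).trans ?_
      rw [ENNReal.ofReal_add (mul_nonneg (abs_nonneg x) (hpow _ _)) (hpow _ _),
        ENNReal.ofReal_mul (abs_nonneg x)]
      refine add_le_add ?_ le_rfl
      have hcases : h = x ^ 2 + -1 * x + (τ + ξ) ∨ h = x ^ 2 + 1 * x + (τ - ξ) := by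
        simp only [hh, phaseS, phaseW, sq_abs]
        rcases units_int_cast_eq σ with hσ | hσ <;> rw [hσ] <;>
          rcases abs_cases (ξ - x) with ⟨h', _⟩ | ⟨h', _⟩ <;> rw [h'] <;>
          first | (left; ring1) | (right; ring1)
      rcases hcases with h' | h' <;> rw [h']
      · exact le_add_of_nonneg_right zero_le
      · exact le_add_of_nonneg_left zero_le
    calc _ ≤ ∫⁻ t : ℝ, ENNReal.ofReal (|x| * bracket x ^ (-(2 * ε)) * bracket h ^ (-(1 - δ))) *
          (2 * (e (t + phaseS x) + e (τ + phaseW σ (ξ - x) - t))) := by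
          refine lintegral_mono fun t => ?_
          have hsum : t + phaseS x + (τ - t + phaseW σ (ξ - x)) = h := by rw [hh]; ring
          have h1 := inv_bracket_mul_inv_bracket_le hδ hδ1 (t + phaseS x)
            (τ - t + phaseW σ (ξ - x))
          rw [hsum] at h1
          have h2 : τ - t + phaseW σ (ξ - x) = τ + phaseW σ (ξ - x) - t := by ring
          rw [h2] at h1 ⊢
          have h0 : 0 ≤ |x| * bracket x ^ (-(2 * ε)) := mul_nonneg (abs_nonneg x) (hpow _ _)
          refine (ENNReal.ofReal_le_ofReal (mul_le_mul_of_nonneg_left h1 h0)).trans ?_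
          rw [← mul_assoc, ENNReal.ofReal_mul (mul_nonneg h0 (hpow _ _)),
            ENNReal.ofReal_mul (by norm_num : (0 : ℝ) ≤ 2),
            ENNReal.ofReal_add (hpow _ _) (hpow _ _)]
          simp [he]
      _ = ENNReal.ofReal (|x| * bracket x ^ (-(2 * ε)) * bracket h ^ (-(1 - δ))) *
          (2 * (J + J)) := by
          have hm1 : Measurable fun t => e (t + phaseS x) := hem.comp (measurable_add_const _)
          have hm2 : Measurable fun t => e (τ + phaseW σ (ξ - x) - t) :=
            hem.comp (measurable_const.sub measurable_id)
          have hm : Measurable fun t => e (t + phaseS x) + e (τ + phaseW σ (ξ - x) - t) :=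
            hm1.add hm2
          rw [lintegral_const_mul _ (hm.const_mul 2), lintegral_const_mul _ hm,
            lintegral_add_left hm1,
            lintegral_add_right_eq_self e, lintegral_sub_left_eq_self e]
          rfl
      _ ≤ _ := by gcongr
  refine (lintegral_mono inner_le).trans ?_
  have hq : ∀ a b : ℝ, Measurable fun x : ℝ => ENNReal.ofReal |x| * e (x ^ 2 + a * x + b) := by
    intro a b
    exact (measurable_id.abs.ennreal_ofReal).mul (hem.comp (by fun_prop))
  have hq2 : Measurable fun x : ℝ => ENNReal.ofReal |x| * e (x ^ 2 + -1 * x + (τ + ξ)) +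
      ENNReal.ofReal |x| * e (x ^ 2 + 1 * x + (τ - ξ)) := (hq _ _).add (hq _ _)
  have hq3 : Measurable fun x : ℝ => ENNReal.ofReal |x| * e (x ^ 2 + -1 * x + (τ + ξ)) +
      ENNReal.ofReal |x| * e (x ^ 2 + 1 * x + (τ - ξ)) + e x := hq2.add hem
  rw [lintegral_mul_const _ hq3,
    lintegral_add_left hq2, lintegral_add_left (hq _ _)]
  gcongr
  · exact lintegral_abs_mul_bracket_quadratic_le hδ (.inr rfl) _
  · exact lintegral_abs_mul_bracket_quadratic_le hδ (.inl rfl) _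
  · exact le_rfl

/-! ### Tempered distributions that are functions -/

theorem IsFunction.locallyIntegrable {f : 𝓢'(Plane, ℂ)} {g : Plane → ℂ} (h : IsFunction f g) :
    LocallyIntegrable g := by
  intro x
  let χ : ContDiffBump x := ⟨1, 2, one_pos, by norm_num⟩
  have hs : HasCompactSupport (Complex.ofRealCLM ∘ χ) := χ.hasCompactSupport.comp_left rfl
  have hc : ContDiff ℝ ((⊤ : ℕ∞) : WithTop ℕ∞) (Complex.ofRealCLM ∘ χ) :=
    Complex.ofRealCLM.contDiff.comp χ.contDiff
  have hi := (h.2 (hs.toSchwartzMap hc)).1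
  refine ⟨Metric.closedBall x 1, Metric.closedBall_mem_nhds x one_pos, ?_⟩
  refine (hi.integrableOn (s := Metric.closedBall x 1)).congr_fun (fun z hz => ?_)
    Metric.isClosed_closedBall.measurableSet
  have : χ z = 1 := χ.one_of_mem_closedBall hz
  simp [this]

theorem IsFunction.ae_eq {f : 𝓢'(Plane, ℂ)} {g₁ g₂ : Plane → ℂ} (h₁ : IsFunction f g₁)
    (h₂ : IsFunction f g₂) : g₁ =ᵐ[volume] g₂ := by
  refine ae_eq_of_integral_contDiff_smul_eq h₁.locallyIntegrable h₂.locallyIntegrable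
    fun χ hχ hs => ?_
  have hs' : HasCompactSupport (Complex.ofRealCLM ∘ χ) := hs.comp_left rfl
  have hc : ContDiff ℝ ((⊤ : ℕ∞) : WithTop ℕ∞) (Complex.ofRealCLM ∘ χ) :=
    Complex.ofRealCLM.contDiff.comp hχ
  have e₁ := (h₁.2 (hs'.toSchwartzMap hc)).2
  have e₂ := (h₂.2 (hs'.toSchwartzMap hc)).2
  simpa using e₁.symm.trans e₂

theorem isFunction_toTemperedDistribution (F : Lp ℂ 2 (volume : Measure Plane)) :
    IsFunction (F : 𝓢'(Plane, ℂ)) F := by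
  refine ⟨Lp.aestronglyMeasurable F, fun ψ => ⟨?_, by simp⟩⟩
  exact (ψ.memLp 2).integrable_mul (Lp.memLp F)

/-- The norm is attained by every representative of the Fourier transform. -/
theorem xNorm_eq {φ : ℝ → ℝ} {m b : ℝ} {f : 𝓢'(Plane, ℂ)} {g : Plane → ℂ}
    (hg : IsFunction (𝓕 f) g) :
    xNorm φ m b f = eLpNorm (fun ζ => (weight φ m b ζ : ℂ) * g ζ) 2 volume := by
  refine le_antisymm (iInf₂_le g hg) (le_iInf₂ fun g' hg' => le_of_eq ?_)
  refine eLpNorm_congr_ae ?_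
  filter_upwards [hg.ae_eq hg'] with ζ h
  rw [h]

theorem exists_isFunction_of_xNorm_lt_top {φ : ℝ → ℝ} {m b : ℝ} {f : 𝓢'(Plane, ℂ)}
    (h : xNorm φ m b f < ∞) : ∃ g, IsFunction (𝓕 f) g := by
  by_contra! hg
  refine h.ne ?_
  simp [xNorm, hg]

/-! ### The inverse Fourier transform on `L¹` and `L²` -/

theorem integral_mul_fourierInv {g : Plane → ℂ} (hg : Integrable g) (ψ : 𝓢(Plane, ℂ)) :
    ∫ z, ψ z * 𝓕⁻ g z = ∫ ζ, (𝓕⁻ ψ) ζ * g ζ := by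
  have h := VectorFourier.integral_fourierIntegral_smul_eq_flip (L := innerₗ Plane)
    (μ := volume) (ν := volume) Real.continuous_fourierChar continuous_inner ψ.integrable
    hg.comp_neg
  rw [flip_innerₗ] at h
  calc ∫ z, ψ z * 𝓕⁻ g z = ∫ z, ψ z • 𝓕 (fun x => g (-x)) z := by
        rw [Real.fourierInv_eq_fourier_comp_neg]; rfl
    _ = ∫ ζ, 𝓕 (ψ : Plane → ℂ) ζ • g (-ζ) := h.symm
    _ = ∫ ζ, 𝓕 (ψ : Plane → ℂ) (-ζ) • g ζ := by
        rw [← integral_neg_eq_self]; simp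
    _ = _ := by
        refine integral_congr_ae (.of_forall fun ζ => ?_)
        simp only [smul_eq_mul]
        rw [SchwartzMap.fourierInv_coe, Real.fourierInv_eq_fourier_neg]

theorem continuous_fourierInv {g : Plane → ℂ} (hg : Integrable g) : Continuous (𝓕⁻ g) := by
  rw [Real.fourierInv_eq_fourier_comp_neg]
  exact VectorFourier.fourierIntegral_continuous Real.continuous_fourierChar continuous_inner
    hg.comp_neg

theorem norm_fourierInv_le (g : Plane → ℂ) (z : Plane) : ‖𝓕⁻ g z‖ ≤ ∫ ζ, ‖g ζ‖ := by
  rw [Real.fourierInv_eq]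
  refine (norm_integral_le_integral_norm _).trans (le_of_eq ?_)
  simp

theorem fourierInv_sub {f g : Plane → ℂ} (hf : Integrable f) (hg : Integrable g) :
    𝓕⁻ (f - g) = 𝓕⁻ f - 𝓕⁻ g := by
  ext z
  simp only [Real.fourierInv_eq, Pi.sub_apply, smul_sub]
  refine integral_sub ?_ ?_
  · simpa using (Real.fourierIntegral_convergent_iff (-z)).2 hf
  · simpa using (Real.fourierIntegral_convergent_iff (-z)).2 hg

theorem fourierInv_fourier_schwartz (ψ : 𝓢(Plane, ℂ)) :
    𝓕⁻ ((𝓕 ψ : 𝓢(Plane, ℂ)) : Plane → ℂ) = ψ := by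
  rw [← SchwartzMap.fourierInv_coe, FourierTransform.fourierInv_fourier_eq]

/-- On `L¹ ∩ L²` the integral and the `L²` extension define the same inverse Fourier transform. -/
theorem fourierInv_toLp_ae_eq {g : Plane → ℂ} (hg : Integrable g) (hg2 : MemLp g 2) :
    (𝓕⁻ (hg2.toLp g) : Lp ℂ 2 (volume : Measure Plane)) =ᵐ[volume] 𝓕⁻ g := by
  refine (isFunction_toTemperedDistribution (𝓕⁻ (hg2.toLp g))).ae_eq
    ⟨(continuous_fourierInv hg).aestronglyMeasurable, fun ψ => ⟨?_, ?_⟩⟩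
  · exact ψ.integrable.mul_bdd (continuous_fourierInv hg).aestronglyMeasurable
      (.of_forall fun z => norm_fourierInv_le g z)
  · rw [integral_mul_fourierInv hg, ← Lp.fourierInv_toTemperedDistribution_eq,
      TemperedDistribution.fourierInv_apply, Lp.toTemperedDistribution_apply]
    refine integral_congr_ae ?_
    filter_upwards [hg2.coeFn_toLp] with ζ h
    rw [h, smul_eq_mul]

theorem eLpNorm_fourierInv_Lp (F : Lp ℂ 2 (volume : Measure Plane)) :
    eLpNorm (𝓕⁻ F : Lp ℂ 2 (volume : Measure Plane)) 2 volume = eLpNorm F 2 volume := by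
  have h := Lp.norm_fourier_eq (𝓕⁻ F)
  rw [FourierTransform.fourier_fourierInv_eq] at h
  rw [← Lp.enorm_def, ← Lp.enorm_def, ← ofReal_norm, ← ofReal_norm, h]

theorem eLpNorm_fourierInv {g : Plane → ℂ} (hg : Integrable g) (hg2 : MemLp g 2) :
    eLpNorm (𝓕⁻ g) 2 volume = eLpNorm g 2 volume := by
  rw [← eLpNorm_congr_ae (fourierInv_toLp_ae_eq hg hg2), eLpNorm_fourierInv_Lp,
    eLpNorm_congr_ae hg2.coeFn_toLp]

/-- Plancherel's theorem for a product: its `L²` norm is that of a convolution, and hence at most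
that of the convolution of the absolute values. -/
theorem eLpNorm_fourierInv_mul_le {f g : Plane → ℂ} (hf : Integrable f) (hg : Integrable g) :
    eLpNorm (fun z => 𝓕⁻ f z * 𝓕⁻ g z) 2 volume ≤
      (∫⁻ z, (∫⁻ t, ‖f t‖ₑ * ‖g (z - t)‖ₑ) ^ 2) ^ (1 / 2 : ℝ) := by
  set k : Plane → ℂ := convolution f g (ContinuousLinearMap.mul ℂ ℂ) volume with hk
  have hk1 : Integrable k := hf.integrable_convolution _ hg
  have hkf : (fun z => 𝓕⁻ f z * 𝓕⁻ g z) = 𝓕⁻ k := by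
    ext z
    simp only [Real.fourierInv_eq_fourier_neg]
    exact (Real.fourier_mul_convolution_eq hf hg (-z)).symm
  have hkn : eLpNorm k 2 volume ≤ (∫⁻ z, (∫⁻ t, ‖f t‖ₑ * ‖g (z - t)‖ₑ) ^ 2) ^ (1 / 2 : ℝ) := by
    rw [eLpNorm_eq_lintegral_rpow_enorm_toReal (by norm_num) (by norm_num)]
    simp only [ENNReal.toReal_ofNat]
    refine ENNReal.rpow_le_rpow (lintegral_mono fun z => ?_) (by norm_num)
    rw [ENNReal.rpow_ofNat]
    refine pow_le_pow_left' ?_ 2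
    refine (enorm_integral_le_lintegral_enorm _).trans (le_of_eq ?_)
    simp [enorm_mul]
  by_cases htop : eLpNorm k 2 volume = ∞
  · rw [htop, top_le_iff] at hkn
    exact hkn ▸ le_top
  · rw [hkf, eLpNorm_fourierInv hk1 ⟨hk1.aestronglyMeasurable, lt_top_iff_ne_top.2 htop⟩]
    exact hkn

/-! ### The bilinear estimate for integrable Fourier transforms -/

theorem lintegral_comp_mul_left_le {a : ℝ} (ha : 1 ≤ a) {F : ℝ → ℝ≥0∞} (hF : Measurable F) :
    ∫⁻ x, F (a * x) ≤ ∫⁻ x, F x := by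
  have h0 : a ≠ 0 := by positivity
  have h : ∫⁻ x, F x = ENNReal.ofReal |a| * ∫⁻ x, F (a * x) := by
    conv_lhs => rw [← Real.smul_map_volume_mul_left h0]
    rw [lintegral_smul_measure, lintegral_map hF (measurable_const_mul a), smul_eq_mul]
  rw [h]
  refine le_mul_of_one_le_left zero_le ?_
  rw [ENNReal.one_le_ofReal]
  exact ha.trans (le_abs_self a)

theorem measurable_freqX : Measurable freqX := by unfold freqX; fun_prop

theorem measurable_freqT : Measurable freqT := by unfold freqT; fun_prop

theorem lintegral_plane_le {F : ℝ → ℝ → ℝ≥0∞} (hF : Measurable (Function.uncurry F)) :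
    ∫⁻ ζ : Plane, F (freqX ζ) (freqT ζ) ≤ ∫⁻ x : ℝ, ∫⁻ t : ℝ, F x t := by
  have hπ : (1 : ℝ) ≤ 2 * Real.pi := by linarith [Real.pi_gt_three]
  have hp := (volume_preserving_finTwoArrow ℝ).comp (PiLp.volume_preserving_ofLp (Fin 2))
  have hm : Measurable fun p : ℝ × ℝ => F (2 * Real.pi * p.1) (2 * Real.pi * p.2) :=
    hF.comp (by fun_prop : Measurable fun p : ℝ × ℝ => (2 * Real.pi * p.1, 2 * Real.pi * p.2))
  have h := hp.lintegral_comp hm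
  calc ∫⁻ ζ : Plane, F (freqX ζ) (freqT ζ)
      = ∫⁻ p : ℝ × ℝ, F (2 * Real.pi * p.1) (2 * Real.pi * p.2) := by rw [← h]; rfl
    _ = ∫⁻ x : ℝ, ∫⁻ t : ℝ, F (2 * Real.pi * x) (2 * Real.pi * t) :=
        lintegral_prod _ hm.aemeasurable
    _ ≤ ∫⁻ x : ℝ, ∫⁻ t : ℝ, F (2 * Real.pi * x) t := by
        refine lintegral_mono fun x => lintegral_comp_mul_left_le hπ ?_
        exact hF.comp (measurable_const.prodMk measurable_id)
    _ ≤ _ := lintegral_comp_mul_left_le hπ hF.lintegral_prod_right'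

theorem weight_pos (φ : ℝ → ℝ) (m b : ℝ) (ζ : Plane) : 0 < weight φ m b ζ :=
  mul_pos (Real.rpow_pos_of_pos (bracket_pos _) _) (Real.rpow_pos_of_pos (bracket_pos _) _)

theorem measurable_weight {φ : ℝ → ℝ} (hφ : Measurable φ) (m b : ℝ) :
    Measurable (weight φ m b) := by
  have h1 := measurable_freqX
  have h2 := measurable_freqT
  have h3 := continuous_bracket.measurable
  exact ((h3.comp h1).pow_const m).mul ((h3.comp (h2.add (hφ.comp h1))).pow_const b)

theorem measurable_phaseS : Measurable phaseS := by unfold phaseS; fun_prop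

theorem measurable_phaseW (σ : ℤˣ) : Measurable (phaseW σ) := by unfold phaseW; fun_prop

/-- Cauchy–Schwarz in the inner variable, followed by Tonelli: a weighted convolution is bounded
on `L²` by the supremum of the convolution of the squared weights. -/
theorem lintegral_sq_convolution_le {a b F H : Plane → ℝ≥0∞} (ha : Measurable a)
    (hb : Measurable b) (hF : AEMeasurable F) (hH : AEMeasurable H) {K : ℝ≥0∞}
    (hK : ∀ z, ∫⁻ t, a t ^ 2 * b (z - t) ^ 2 ≤ K) :
    ∫⁻ z, (∫⁻ t, (a t * F t) * (b (z - t) * H (z - t))) ^ 2 ≤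
      K * ((∫⁻ t, F t ^ 2) * ∫⁻ t, H t ^ 2) := by
  have hHz : ∀ z : Plane, AEMeasurable fun t => H (z - t) := fun z =>
    hH.comp_quasiMeasurePreserving (quasiMeasurePreserving_sub_left _ z)
  have hcs : ∀ z, (∫⁻ t, (a t * F t) * (b (z - t) * H (z - t))) ^ 2 ≤
      K * ∫⁻ t, F t ^ 2 * H (z - t) ^ 2 := by
    intro z
    have h1 : AEMeasurable fun t => a t * b (z - t) :=
      (ha.mul (hb.comp (measurable_const.sub measurable_id))).aemeasurable
    have h2 : AEMeasurable fun t => F t * H (z - t) := hF.mul (hHz z)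
    have h := ENNReal.lintegral_mul_le_Lp_mul_Lq volume Real.HolderConjugate.two_two h1 h2
    have h' := pow_le_pow_left' h 2
    rw [mul_pow, ← ENNReal.rpow_mul_natCast, ← ENNReal.rpow_mul_natCast] at h'
    norm_num [mul_pow] at h'
    calc _ = (∫⁻ t, a t * b (z - t) * (F t * H (z - t))) ^ 2 := by
          congr 1; refine lintegral_congr fun t => ?_; ring
      _ ≤ _ := h'
      _ ≤ _ := by gcongr; exact hK z
  calc _ ≤ ∫⁻ z, K * ∫⁻ t, F t ^ 2 * H (z - t) ^ 2 := lintegral_mono hcs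
    _ = K * ∫⁻ z, ∫⁻ t, F t ^ 2 * H (z - t) ^ 2 := by
        refine lintegral_const_mul'' _ ?_
        have : AEMeasurable (fun p : Plane × Plane => F p.2 ^ 2 * H (p.1 - p.2) ^ 2)
            (volume.prod volume) :=
          (hF.comp_quasiMeasurePreserving Measure.quasiMeasurePreserving_snd).pow_const 2 |>.mul
            ((hH.comp_quasiMeasurePreserving (quasiMeasurePreserving_sub _ _)).pow_const 2)
        exact this.lintegral_prod_right'
    _ = K * ∫⁻ t, ∫⁻ z, F t ^ 2 * H (z - t) ^ 2 := by
        congr 1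
        refine lintegral_lintegral_swap ?_
        exact (hF.comp_quasiMeasurePreserving Measure.quasiMeasurePreserving_snd).pow_const 2 |>.mul
            ((hH.comp_quasiMeasurePreserving (quasiMeasurePreserving_sub _ _)).pow_const 2)
    _ = K * ∫⁻ t, F t ^ 2 * ∫⁻ z, H z ^ 2 := by
        congr 1
        refine lintegral_congr fun t => ?_
        rw [lintegral_const_mul'' _ ?_, lintegral_sub_right_eq_self fun z => H z ^ 2]
        exact (hH.comp_quasiMeasurePreserving
          (measurePreserving_sub_right _ t).quasiMeasurePreserving).pow_const 2
    _ = _ := by rw [lintegral_mul_const'' _ (hF.pow_const 2)]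

/-- The multiplier `|ξ|^{1/2}` of `D_x^{1/2}`. -/
noncomputable def halfDeriv (ζ : Plane) : ℝ := |freqX ζ| ^ (1 / 2 : ℝ)

theorem measurable_halfDeriv : Measurable halfDeriv := measurable_freqX.abs.pow_const _

theorem sq_halfDeriv (ζ : Plane) : halfDeriv ζ ^ 2 = |freqX ζ| := by
  rw [halfDeriv, ← Real.sqrt_eq_rpow, Real.sq_sqrt (abs_nonneg _)]

theorem halfDeriv_nonneg (ζ : Plane) : 0 ≤ halfDeriv ζ := Real.rpow_nonneg (abs_nonneg _) _

theorem sq_weight_half (φ : ℝ → ℝ) (m : ℝ) (ζ : Plane) :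
    weight φ m (1 / 2) ζ ^ 2 =
      bracket (freqX ζ) ^ (2 * m) * bracket (freqT ζ + φ (freqX ζ)) := by
  rw [weight, mul_pow, ← Real.rpow_natCast, ← Real.rpow_natCast,
    ← Real.rpow_mul (bracket_pos _).le, ← Real.rpow_mul (bracket_pos _).le]
  have h1 : m * ((2 : ℕ) : ℝ) = 2 * m := by push_cast; ring
  have h2 : 1 / 2 * ((2 : ℕ) : ℝ) = 1 := by norm_num
  rw [h1, h2, Real.rpow_one]

/-- The bilinear estimate when both Fourier transforms are integrable. -/
theorem exists_eLpNorm_fourierInv_mul_le {ε : ℝ} (hε : 0 < ε) :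
    ∃ C : ℝ≥0, ∀ (σ : ℤˣ) (g h : Plane → ℂ), AEStronglyMeasurable g volume →
      Integrable (fun ζ => (halfDeriv ζ : ℂ) * g ζ) → Integrable h →
      eLpNorm (fun z => 𝓕⁻ (fun ζ => (halfDeriv ζ : ℂ) * g ζ) z * 𝓕⁻ h z) 2 volume ≤
        C * eLpNorm (fun ζ => (weight (phaseW σ) 0 (1 / 2) ζ : ℂ) * h ζ) 2 volume *
          eLpNorm (fun ζ => (weight phaseS ε (1 / 2) ζ : ℂ) * g ζ) 2 volume := by
  obtain ⟨K, hK, hker⟩ := exists_lintegral_kernel_le hε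
  refine ⟨(K ^ (1 / 2 : ℝ)).toNNReal, fun σ g h hgm hg hh => ?_⟩
  rw [ENNReal.coe_toNNReal (by simp [hK.ne])]
  set wS := weight phaseS ε (1 / 2) with hwS
  set wW := weight (phaseW σ) 0 (1 / 2) with hwW
  have mS : Measurable wS := measurable_weight measurable_phaseS _ _
  have mW : Measurable wW := measurable_weight (measurable_phaseW σ) _ _
  set a : Plane → ℝ≥0∞ := fun ζ => ENNReal.ofReal (halfDeriv ζ / wS ζ) with ha
  set b : Plane → ℝ≥0∞ := fun ζ => ENNReal.ofReal (1 / wW ζ) with hb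
  have hgf : ∀ ζ, ‖(halfDeriv ζ : ℂ) * g ζ‖ₑ = a ζ * ‖(wS ζ : ℂ) * g ζ‖ₑ := by
    intro ζ
    have hp : 0 < wS ζ := weight_pos _ _ _ _
    rw [enorm_mul, enorm_mul, ← mul_assoc]
    congr 1
    rw [← ofReal_norm, ← ofReal_norm, Complex.norm_real, Complex.norm_real, ha,
      ← ENNReal.ofReal_mul (div_nonneg (halfDeriv_nonneg ζ) hp.le), Real.norm_of_nonneg hp.le,
      Real.norm_of_nonneg (halfDeriv_nonneg ζ), div_mul_cancel₀ _ hp.ne']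
  have hhf : ∀ ζ, ‖h ζ‖ₑ = b ζ * ‖(wW ζ : ℂ) * h ζ‖ₑ := by
    intro ζ
    have hp : 0 < wW ζ := weight_pos _ _ _ _
    rw [enorm_mul, ← mul_assoc]
    conv_lhs => rw [← one_mul ‖h ζ‖ₑ]
    congr 1
    rw [← ofReal_norm, Complex.norm_real, hb,
      ← ENNReal.ofReal_mul (by positivity), Real.norm_of_nonneg hp.le, div_mul_cancel₀ _ hp.ne',
      ENNReal.ofReal_one]
  have hab : ∀ z, ∫⁻ t, a t ^ 2 * b (z - t) ^ 2 ≤ K := by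
    intro z
    refine le_trans (le_of_eq ?_)
      ((lintegral_plane_le (F := fun x t => ENNReal.ofReal (|x| * bracket x ^ (-(2 * ε)) *
        ((bracket (t + phaseS x))⁻¹ * (bracket (freqT z - t + phaseW σ (freqX z - x)))⁻¹)))
        ?_).trans (hker σ (freqX z) (freqT z)))
    · refine lintegral_congr fun ζ => ?_
      have hX : freqX (z - ζ) = freqX z - freqX ζ := by simp [freqX]; ring
      have hT : freqT (z - ζ) = freqT z - freqT ζ := by simp [freqT]; ring
      rw [ha, hb]
      simp only
      rw [← mul_pow, ← ENNReal.ofReal_mul (div_nonneg (halfDeriv_nonneg ζ) (weight_pos _ _ _ _).le),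
        ← ENNReal.ofReal_pow (mul_nonneg (div_nonneg (halfDeriv_nonneg ζ) (weight_pos _ _ _ _).le)
          (one_div_nonneg.2 (weight_pos _ _ _ _).le))]
      congr 1
      rw [mul_pow, div_pow, div_pow, sq_halfDeriv, sq_weight_half, sq_weight_half, hX, hT,
        Real.rpow_neg (bracket_pos _).le]
      simp only [mul_zero, Real.rpow_zero, one_mul, one_pow]
      rw [div_eq_mul_inv, mul_inv]
      ring
    · have := continuous_bracket.measurable
      have h1 : Measurable fun p : ℝ × ℝ => bracket p.1 := this.comp measurable_fst
      have h2 : Measurable fun p : ℝ × ℝ => bracket (p.2 + phaseS p.1) :=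
        this.comp (measurable_snd.add (measurable_phaseS.comp measurable_fst))
      have h3 : Measurable fun p : ℝ × ℝ =>
          bracket (freqT z - p.2 + phaseW σ (freqX z - p.1)) :=
        this.comp ((measurable_const.sub measurable_snd).add
          ((measurable_phaseW σ).comp (measurable_const.sub measurable_fst)))
      exact ((measurable_fst.abs.mul (h1.pow_const _)).mul (h2.inv.mul h3.inv)).ennreal_ofReal
  have am : Measurable a := (measurable_halfDeriv.div mS).ennreal_ofReal
  have bm : Measurable b := (measurable_const.div mW).ennreal_ofReal
  have gm : AEMeasurable fun ζ => ‖(wS ζ : ℂ) * g ζ‖ₑ :=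
    ((Complex.measurable_ofReal.comp mS).aestronglyMeasurable.mul hgm).enorm
  have hm : AEMeasurable fun ζ => ‖(wW ζ : ℂ) * h ζ‖ₑ :=
    ((Complex.measurable_ofReal.comp mW).aestronglyMeasurable.mul hh.aestronglyMeasurable).enorm
  refine (eLpNorm_fourierInv_mul_le hg hh).trans ?_
  simp only [hgf, hhf]
  refine (ENNReal.rpow_le_rpow (lintegral_sq_convolution_le am bm gm hm hab)
    (by norm_num)).trans (le_of_eq ?_)
  rw [ENNReal.mul_rpow_of_nonneg _ _ (by norm_num), ENNReal.mul_rpow_of_nonneg _ _ (by norm_num),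
    eLpNorm_eq_lintegral_rpow_enorm_toReal (by norm_num) (by norm_num),
    eLpNorm_eq_lintegral_rpow_enorm_toReal (by norm_num) (by norm_num)]
  simp only [ENNReal.toReal_ofNat, ENNReal.rpow_ofNat]
  ring

/-! ### Frequency truncation and polynomial weights -/

/-- The restriction of `g` to the frequencies `‖ζ‖ ≤ k`, extended by zero. -/
noncomputable def trunc (k : ℕ) (g : Plane → ℂ) : Plane → ℂ :=
  (Metric.closedBall (0 : Plane) k).indicator g

/-- The part of `g` at frequencies `‖ζ‖ > k`. -/
noncomputable def tail (k : ℕ) (g : Plane → ℂ) : Plane → ℂ :=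
  (Metric.closedBall (0 : Plane) k)ᶜ.indicator g

theorem norm_trunc_le (k : ℕ) (g : Plane → ℂ) (ζ : Plane) : ‖trunc k g ζ‖ ≤ ‖g ζ‖ :=
  norm_indicator_le_norm_self g ζ

theorem trunc_sub_self (k : ℕ) (g : Plane → ℂ) : trunc k g - g = -tail k g := by
  have h := Set.indicator_self_add_compl (Metric.closedBall (0 : Plane) k) g
  unfold trunc tail
  nth_rewrite 2 [← h]
  abel

theorem norm_trunc_sub_trunc_le {k l : ℕ} (h : k ≤ l) (g : Plane → ℂ) (ζ : Plane) :
    ‖trunc l g ζ - trunc k g ζ‖ ≤ ‖tail k g ζ‖ := by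
  have hkl : (k : ℝ) ≤ l := by exact_mod_cast h
  by_cases h1 : ζ ∈ Metric.closedBall (0 : Plane) k
  · have h2 : ζ ∈ Metric.closedBall (0 : Plane) l := Metric.closedBall_subset_closedBall hkl h1
    simp [trunc, h1, h2]
  · simp only [trunc, tail, Set.indicator_of_notMem h1, Set.indicator_of_mem
      (Set.mem_compl h1), sub_zero]
    exact norm_indicator_le_norm_self g ζ

theorem tendsto_trunc (g : Plane → ℂ) (ζ : Plane) :
    Tendsto (fun k => trunc k g ζ) atTop (𝓝 (g ζ)) := by
  obtain ⟨K, hK⟩ := exists_nat_ge ‖ζ‖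
  refine tendsto_const_nhds.congr' ?_
  filter_upwards [eventually_ge_atTop K] with k hk
  have : ζ ∈ Metric.closedBall (0 : Plane) k := by
    simpa using hK.trans (by exact_mod_cast hk)
  simp [trunc, this]

theorem aestronglyMeasurable_trunc {g : Plane → ℂ} (hg : AEStronglyMeasurable g volume) (k : ℕ) :
    AEStronglyMeasurable (trunc k g) volume :=
  hg.indicator Metric.isClosed_closedBall.measurableSet

theorem tendsto_eLpNorm_tail {f : Plane → ℂ} (hf : MemLp f 2) :
    Tendsto (fun k => eLpNorm (tail k f) 2 volume) atTop (𝓝 0) := by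
  have h2 : ∀ k, eLpNorm (tail k f) 2 volume = (∫⁻ ζ, ‖tail k f ζ‖ₑ ^ 2) ^ (1 / 2 : ℝ) := by
    intro k
    rw [eLpNorm_eq_lintegral_rpow_enorm_toReal (by norm_num) (by norm_num)]
    simp
  have hfin : ∫⁻ ζ, ‖f ζ‖ₑ ^ 2 ≠ ∞ := by
    have := (lintegral_rpow_enorm_lt_top_of_eLpNorm_lt_top (by norm_num) (by norm_num) hf.2).ne
    simpa using this
  have hlim : Tendsto (fun k => ∫⁻ ζ, ‖tail k f ζ‖ₑ ^ 2) atTop (𝓝 (∫⁻ _ : Plane, 0)) := by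
    refine tendsto_lintegral_of_dominated_convergence' (fun ζ => ‖f ζ‖ₑ ^ 2) (fun k => ?_)
      (fun k => .of_forall fun ζ => ?_) hfin (.of_forall fun ζ => ?_)
    · exact (hf.1.indicator Metric.isClosed_closedBall.measurableSet.compl).enorm.pow_const 2
    · exact pow_le_pow_left' (enorm_indicator_le_enorm_self f ζ) 2
    · obtain ⟨K, hK⟩ := exists_nat_ge ‖ζ‖
      refine tendsto_const_nhds.congr' ?_
      filter_upwards [eventually_ge_atTop K] with k hk
      have : ζ ∈ Metric.closedBall (0 : Plane) k := by
        simpa using hK.trans (by exact_mod_cast hk)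
      simp [tail, this]
  simp only [h2]
  simpa using hlim.ennrpow_const (1 / 2)

theorem continuous_halfDeriv : Continuous halfDeriv := by
  unfold halfDeriv freqX
  exact (by fun_prop : Continuous fun ζ : Plane => |2 * Real.pi * ζ 0|).rpow_const
    fun _ => .inr (by norm_num)

theorem integrable_trunc {g : Plane → ℂ} (hg : LocallyIntegrable g) (k : ℕ) :
    Integrable (trunc k g) :=
  (integrable_indicator_iff Metric.isClosed_closedBall.measurableSet).2
    (hg.integrableOn_isCompact (isCompact_closedBall 0 k))

theorem integrable_halfDeriv_mul_trunc {g : Plane → ℂ} (hg : LocallyIntegrable g) (k : ℕ) :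
    Integrable fun ζ => (halfDeriv ζ : ℂ) * trunc k g ζ := by
  have hi := (hg.integrableOn_isCompact (isCompact_closedBall (0 : Plane) k)).continuousOn_mul
    (Complex.continuous_ofReal.comp continuous_halfDeriv).continuousOn
    (isCompact_closedBall (0 : Plane) k)
  refine ((integrable_indicator_iff Metric.isClosed_closedBall.measurableSet).2 hi).congr
    (.of_forall fun ζ => ?_)
  by_cases h : ζ ∈ Metric.closedBall (0 : Plane) k <;> simp [trunc, h]

/-- The weight `1 + ‖z‖²`. -/
noncomputable def polyWeight (z : Plane) : ℂ := ((1 + ‖z‖ ^ 2 : ℝ) : ℂ)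

theorem norm_polyWeight (z : Plane) : ‖polyWeight z‖ = 1 + ‖z‖ ^ 2 := by
  rw [polyWeight, Complex.norm_real, Real.norm_of_nonneg (by positivity)]

theorem polyWeight_ne_zero (z : Plane) : polyWeight z ≠ 0 := by
  rw [← norm_pos_iff, norm_polyWeight]; positivity

theorem continuous_polyWeight : Continuous polyWeight := by unfold polyWeight; fun_prop

theorem hasTemperateGrowth_polyWeight : polyWeight.HasTemperateGrowth := by
  have h : (fun z : Plane => (1 : ℝ) + ‖z‖ ^ 2).HasTemperateGrowth :=
    (Function.HasTemperateGrowth.const 1).add (Function.hasTemperateGrowth_norm_sq Plane)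
  exact Complex.ofRealCLM.hasTemperateGrowth.comp h

/-- The Schwartz function `(1 + ‖z‖²) ψ`. -/
noncomputable def polyMul (ψ : 𝓢(Plane, ℂ)) : 𝓢(Plane, ℂ) :=
  SchwartzMap.smulLeftCLM ℂ polyWeight ψ

theorem polyMul_apply (ψ : 𝓢(Plane, ℂ)) (z : Plane) : polyMul ψ z = polyWeight z * ψ z :=
  SchwartzMap.smulLeftCLM_apply_apply hasTemperateGrowth_polyWeight ψ z

theorem memLp_inv_polyWeight : MemLp (fun z => (polyWeight z)⁻¹) 2 (volume : Measure Plane) := by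
  have hm : AEStronglyMeasurable (fun z => (polyWeight z)⁻¹) (volume : Measure Plane) :=
    (continuous_polyWeight.inv₀ polyWeight_ne_zero).aestronglyMeasurable
  rw [memLp_two_iff_integrable_sq_norm hm]
  have h := integrable_rpow_neg_one_add_norm_sq (E := Plane) (μ := volume) (r := 4)
    (by simp; norm_num)
  refine h.congr (.of_forall fun z => ?_)
  simp only
  have h4 : (-4 / 2 : ℝ) = -((2 : ℕ) : ℝ) := by norm_num
  rw [norm_inv, norm_polyWeight, inv_pow, h4, Real.rpow_neg (by positivity), Real.rpow_natCast]

theorem abs_freqX_le (ζ : Plane) : |freqX ζ| ≤ 2 * Real.pi * ‖ζ‖ := by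
  rw [freqX, abs_mul, abs_of_pos Real.two_pi_pos]
  gcongr
  exact PiLp.norm_apply_le ζ 0

theorem abs_freqT_le (ζ : Plane) : |freqT ζ| ≤ 2 * Real.pi * ‖ζ‖ := by
  rw [freqT, abs_mul, abs_of_pos Real.two_pi_pos]
  gcongr
  exact PiLp.norm_apply_le ζ 1

theorem rpow_half_le_self {x : ℝ} (hx : 1 ≤ x) : x ^ (1 / 2 : ℝ) ≤ x := by
  simpa using Real.rpow_le_rpow_of_exponent_le hx (by norm_num : (1 / 2 : ℝ) ≤ 1)

theorem one_add_le_polyWeight (ζ : Plane) :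
    1 + 4 * Real.pi * ‖ζ‖ ≤ 9 * ‖polyWeight ζ‖ := by
  rw [norm_polyWeight]
  nlinarith [Real.pi_lt_four, Real.pi_pos, sq_nonneg (‖ζ‖ - 1), norm_nonneg ζ]

theorem halfDeriv_le (ζ : Plane) : halfDeriv ζ ≤ 9 * ‖polyWeight ζ‖ := by
  have h := abs_freqX_le ζ
  have hp : 0 ≤ Real.pi * ‖ζ‖ := by positivity
  calc halfDeriv ζ ≤ (1 + |freqX ζ|) ^ (1 / 2 : ℝ) :=
        Real.rpow_le_rpow (abs_nonneg _) (by linarith) (by norm_num)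
    _ ≤ 1 + |freqX ζ| := rpow_half_le_self (by linarith [abs_nonneg (freqX ζ)])
    _ ≤ _ := by linarith [one_add_le_polyWeight ζ]

theorem weight_phaseW_le (σ : ℤˣ) (ζ : Plane) :
    weight (phaseW σ) 0 (1 / 2) ζ ≤ 9 * ‖polyWeight ζ‖ := by
  have h1 := abs_freqX_le ζ
  have h2 := abs_freqT_le ζ
  have h3 : |phaseW σ (freqX ζ)| = |freqX ζ| := by
    rcases units_int_cast_eq σ with h | h <;> simp [phaseW, h]
  have h4 := abs_add_le (freqT ζ) (phaseW σ (freqX ζ))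
  calc weight (phaseW σ) 0 (1 / 2) ζ
      = bracket (freqT ζ + phaseW σ (freqX ζ)) ^ (1 / 2 : ℝ) := by simp [weight]
    _ ≤ bracket (freqT ζ + phaseW σ (freqX ζ)) := rpow_half_le_self (one_le_bracket _)
    _ ≤ 1 + |freqT ζ + phaseW σ (freqX ζ)| := bracket_le_one_add_abs _
    _ ≤ _ := by linarith [one_add_le_polyWeight ζ]

/-- Schwartz functions have finite `X_±^{0,1/2}` norm. -/
theorem eLpNorm_weight_mul_schwartz_lt_top (σ : ℤˣ) (ψ : 𝓢(Plane, ℂ)) :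
    eLpNorm (fun ζ => (weight (phaseW σ) 0 (1 / 2) ζ : ℂ) * ψ ζ) 2 volume < ∞ := by
  have h := ((polyMul ψ).memLp (μ := volume) 2).const_mul 9
  refine (eLpNorm_mono fun ζ => ?_).trans_lt h.2
  rw [norm_mul, norm_mul, polyMul_apply, norm_mul, Complex.norm_real,
    Real.norm_of_nonneg (weight_pos _ _ _ _).le, ← mul_assoc]
  gcongr
  simpa using weight_phaseW_le σ ζ

theorem one_le_weight (φ : ℝ → ℝ) {m b : ℝ} (hm : 0 ≤ m) (hb : 0 ≤ b) (ζ : Plane) :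
    1 ≤ weight φ m b ζ :=
  one_le_mul_of_one_le_of_one_le (Real.one_le_rpow (one_le_bracket _) hm)
    (Real.one_le_rpow (one_le_bracket _) hb)

theorem memLp_of_weight_mul {φ : ℝ → ℝ} {m b : ℝ} (hm : 0 ≤ m) (hb : 0 ≤ b) {g : Plane → ℂ}
    (hg : AEStronglyMeasurable g volume)
    (h : eLpNorm (fun ζ => (weight φ m b ζ : ℂ) * g ζ) 2 volume < ∞) : MemLp g 2 := by
  refine ⟨hg, (eLpNorm_mono fun ζ => ?_).trans_lt h⟩
  rw [norm_mul, Complex.norm_real, Real.norm_of_nonneg (weight_pos _ _ _ _).le]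
  exact le_mul_of_one_le_left (norm_nonneg _) (one_le_weight φ hm hb ζ)

/-- The multiplier `|ξ|^{1/2}` has temperate growth in the sense of size, so its product with a
square-integrable function is still integrable against Schwartz functions. -/
theorem integrable_schwartz_mul_halfDeriv_mul {g : Plane → ℂ} (hg : MemLp g 2)
    (ψ : 𝓢(Plane, ℂ)) : Integrable fun ζ => ψ ζ * ((halfDeriv ζ : ℂ) * g ζ) := by
  have h := (((polyMul ψ).memLp 2).integrable_mul hg).const_mul (9 : ℂ)
  refine h.mono (ψ.continuous.aestronglyMeasurable.mul
    ((Complex.continuous_ofReal.comp continuous_halfDeriv).aestronglyMeasurable.mul hg.1))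
    (.of_forall fun ζ => ?_)
  simp only [norm_mul, Pi.mul_apply, polyMul_apply, Complex.norm_real,
    Real.norm_of_nonneg (halfDeriv_nonneg ζ)]
  calc ‖ψ ζ‖ * (halfDeriv ζ * ‖g ζ‖) ≤ ‖ψ ζ‖ * (9 * ‖polyWeight ζ‖ * ‖g ζ‖) := by
        gcongr; exact halfDeriv_le ζ
    _ = ‖(9 : ℂ)‖ * (‖polyWeight ζ‖ * ‖ψ ζ‖ * ‖g ζ‖) := by simp; ring

/-- For `g ∈ L²` there is a tempered distribution with Fourier transform `|ξ|^{1/2} g`. -/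
theorem exists_fourier_isFunction_halfDeriv_mul {g : Plane → ℂ} (hg : MemLp g 2) :
    ∃ w : 𝓢'(Plane, ℂ), IsFunction (𝓕 w) fun ζ => (halfDeriv ζ : ℂ) * g ζ := by
  have hm : AEStronglyMeasurable (fun ζ => (halfDeriv ζ : ℂ) * g ζ) volume :=
    (Complex.continuous_ofReal.comp continuous_halfDeriv).aestronglyMeasurable.mul hg.1
  have hq : MemLp (fun ζ => (polyWeight ζ)⁻¹ * ((halfDeriv ζ : ℂ) * g ζ)) 2 := by
    refine (hg.const_mul 9).mono
      ((continuous_polyWeight.inv₀ polyWeight_ne_zero).aestronglyMeasurable.mul hm)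
      (.of_forall fun ζ => ?_)
    have hp : 0 < ‖polyWeight ζ‖ := norm_pos_iff.2 (polyWeight_ne_zero ζ)
    simp only [norm_mul, norm_inv, Complex.norm_real, Real.norm_of_nonneg (halfDeriv_nonneg ζ)]
    rw [← mul_assoc]
    gcongr
    rw [inv_mul_le_iff₀ hp, mul_comm]
    simpa using halfDeriv_le ζ
  refine ⟨𝓕⁻ (TemperedDistribution.smulLeftCLM ℂ polyWeight (hq.toLp _ : 𝓢'(Plane, ℂ))), ?_⟩
  rw [FourierTransform.fourier_fourierInv_eq]
  refine ⟨hm, fun ψ => ⟨integrable_schwartz_mul_halfDeriv_mul hg ψ, ?_⟩⟩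
  rw [TemperedDistribution.smulLeftCLM_apply_apply, Lp.toTemperedDistribution_apply]
  refine integral_congr_ae ?_
  filter_upwards [hq.coeFn_toLp] with ζ h
  rw [h, SchwartzMap.smulLeftCLM_apply_apply hasTemperateGrowth_polyWeight]
  simp only [smul_eq_mul]
  field_simp [polyWeight_ne_zero ζ]

/-! ### The half derivative as a function -/

/-- The function whose Fourier transform is the truncation of `|ξ|^{1/2} g` to `‖ζ‖ ≤ k`. -/
noncomputable def halfDerivApprox (g : Plane → ℂ) (k : ℕ) : Plane → ℂ :=
  𝓕⁻ fun ζ => (halfDeriv ζ : ℂ) * trunc k g ζ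

theorem continuous_halfDerivApprox {g : Plane → ℂ} (hg : LocallyIntegrable g) (k : ℕ) :
    Continuous (halfDerivApprox g k) :=
  continuous_fourierInv (integrable_halfDeriv_mul_trunc hg k)

/-- The bilinear estimate with a Schwartz function as the second factor: multiplication by `ψ`
makes the truncations a Cauchy sequence in `L²`. -/
theorem exists_eLpNorm_halfDerivApprox_sub_mul_le {ε : ℝ} (hε : 0 < ε) {g : Plane → ℂ}
    (hg : LocallyIntegrable g) (ψ : 𝓢(Plane, ℂ)) :
    ∃ C : ℝ≥0, ∀ k l : ℕ, k ≤ l →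
      eLpNorm (fun z => (halfDerivApprox g l z - halfDerivApprox g k z) * ψ z) 2 volume ≤
        C * eLpNorm (tail k fun ζ => (weight phaseS ε (1 / 2) ζ : ℂ) * g ζ) 2 volume := by
  obtain ⟨C, hC⟩ := exists_eLpNorm_fourierInv_mul_le hε
  have hfin := eLpNorm_weight_mul_schwartz_lt_top 1 (𝓕 ψ)
  refine ⟨C * (eLpNorm (fun ζ => (weight (phaseW 1) 0 (1 / 2) ζ : ℂ) * (𝓕 ψ) ζ) 2 volume).toNNReal,
    fun k l hkl => ?_⟩
  have hl := integrable_halfDeriv_mul_trunc hg l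
  have hk := integrable_halfDeriv_mul_trunc hg k
  have hsub : (fun ζ => (halfDeriv ζ : ℂ) * (trunc l g - trunc k g) ζ) =
      (fun ζ => (halfDeriv ζ : ℂ) * trunc l g ζ) - fun ζ => (halfDeriv ζ : ℂ) * trunc k g ζ := by
    ext ζ; simp [mul_sub]
  have h := hC 1 (trunc l g - trunc k g) (𝓕 ψ : 𝓢(Plane, ℂ))
    ((aestronglyMeasurable_trunc hg.aestronglyMeasurable l).sub
      (aestronglyMeasurable_trunc hg.aestronglyMeasurable k))
    (by rw [hsub]; exact hl.sub hk) (𝓕 ψ : 𝓢(Plane, ℂ)).integrable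
  rw [hsub, fourierInv_sub hl hk, fourierInv_fourier_schwartz] at h
  rw [ENNReal.coe_mul, ENNReal.coe_toNNReal hfin.ne]
  refine h.trans (mul_le_mul' le_rfl (eLpNorm_mono fun ζ => ?_))
  have h1 := norm_trunc_sub_trunc_le hkl g ζ
  have h2 : tail k (fun ζ => (weight phaseS ε (1 / 2) ζ : ℂ) * g ζ) ζ =
      (weight phaseS ε (1 / 2) ζ : ℂ) * tail k g ζ := by
    by_cases h : ζ ∈ Metric.closedBall (0 : Plane) k <;> simp [tail, h]
  rw [h2, norm_mul, norm_mul]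
  gcongr
  exact h1

/-- A Schwartz function that equals one on a prescribed ball. -/
theorem exists_schwartz_eq_one (R : ℕ) :
    ∃ χ : 𝓢(Plane, ℂ), ∀ z : Plane, ‖z‖ ≤ R → χ z = 1 := by
  let χ : ContDiffBump (0 : Plane) := ⟨R + 1, R + 2, by positivity, by linarith⟩
  have hs : HasCompactSupport (Complex.ofRealCLM ∘ χ) := χ.hasCompactSupport.comp_left rfl
  have hc : ContDiff ℝ ((⊤ : ℕ∞) : WithTop ℕ∞) (Complex.ofRealCLM ∘ χ) :=
    Complex.ofRealCLM.contDiff.comp χ.contDiff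
  refine ⟨hs.toSchwartzMap hc, fun z hz => ?_⟩
  have : χ z = 1 := χ.one_of_mem_closedBall (by
    rw [mem_closedBall_zero_iff]; exact hz.trans (by linarith : (R : ℝ) ≤ R + 1))
  simp [this]

/-- Along a subsequence of rapidly decaying tails, the truncations converge almost everywhere:
after multiplication by a bump function consecutive differences are summable in `L²`. -/
theorem exists_ae_tendsto_halfDerivApprox {ε : ℝ} (hε : 0 < ε) {g : Plane → ℂ}
    (hg : LocallyIntegrable g)
    (hW : MemLp (fun ζ => (weight phaseS ε (1 / 2) ζ : ℂ) * g ζ) 2) :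
    ∃ (κ : ℕ → ℕ) (v : Plane → ℂ), StrictMono κ ∧ StronglyMeasurable v ∧
      ∀ᵐ z, Tendsto (fun j => halfDerivApprox g (κ j) z) atTop (𝓝 (v z)) := by
  set e : ℕ → ℝ≥0∞ := fun k =>
    eLpNorm (tail k fun ζ => (weight phaseS ε (1 / 2) ζ : ℂ) * g ζ) 2 volume with he
  have he0 : Tendsto e atTop (𝓝 0) := tendsto_eLpNorm_tail hW
  obtain ⟨κ, hκ, hκe⟩ := extraction_forall_of_eventually'
    (P := fun j k => e k ≤ (2⁻¹ : ℝ≥0∞) ^ j) fun j => by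
      have h := he0.eventually_le_const (u := (2⁻¹ : ℝ≥0∞) ^ j) (by
        refine pos_iff_ne_zero.2 (pow_ne_zero _ ?_); simp)
      exact eventually_atTop.1 h
  have hcont := fun k => continuous_halfDerivApprox hg k
  have hball : ∀ R : ℕ, ∀ᵐ z : Plane, ‖z‖ ≤ R →
      ∃ l, Tendsto (fun j => halfDerivApprox g (κ j) z) atTop (𝓝 l) := by
    intro R
    obtain ⟨χ, hχ⟩ := exists_schwartz_eq_one R
    obtain ⟨C, hC⟩ := exists_eLpNorm_halfDerivApprox_sub_mul_le hε hg χ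
    have hle : ∀ n m : ℕ, n ≤ m →
        eLpNorm (fun z => (halfDerivApprox g (κ m) z - halfDerivApprox g (κ n) z) * χ z) 2 volume ≤
          C * (2⁻¹ : ℝ≥0∞) ^ n := fun n m hnm =>
      (hC _ _ (hκ.monotone hnm)).trans (mul_le_mul' le_rfl (hκe n))
    have hlim := Lp.ae_tendsto_of_cauchy_eLpNorm (μ := volume) (p := 2)
      (f := fun j z => halfDerivApprox g (κ j) z * χ z)
      (B := fun N => (C + 1) * (2⁻¹ : ℝ≥0∞) ^ N)
      (fun j => ((hcont _).mul χ.continuous).aestronglyMeasurable) (by norm_num)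
      (by
        rw [ENNReal.tsum_mul_left, ENNReal.tsum_geometric]
        refine ENNReal.mul_ne_top (by simp) ?_
        simp)
      (fun N n m hn hm => by
        have hlt : (C : ℝ≥0∞) * (2⁻¹ : ℝ≥0∞) ^ N < (C + 1) * (2⁻¹ : ℝ≥0∞) ^ N := by
          refine (ENNReal.mul_lt_mul_iff_left (by simp) (ENNReal.pow_ne_top (by simp))).2 ?_
          exact_mod_cast lt_add_one C
        refine lt_of_le_of_lt ?_ hlt
        have hpow : ∀ {i : ℕ}, N ≤ i →
            (C : ℝ≥0∞) * (2⁻¹ : ℝ≥0∞) ^ i ≤ C * (2⁻¹ : ℝ≥0∞) ^ N := fun hi =>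
          mul_le_mul' le_rfl (pow_le_pow_right_of_le_one' (by simp) hi)
        rcases le_total n m with h | h
        · rw [eLpNorm_sub_comm]
          refine le_trans (le_of_eq ?_) ((hle n m h).trans (hpow hn))
          congr 1; ext z; simp [sub_mul]
        · refine le_trans (le_of_eq ?_) ((hle m n h).trans (hpow hm))
          congr 1; ext z; simp [sub_mul])
    filter_upwards [hlim] with z hz hzR
    simpa [hχ z hzR] using hz
  have hall : ∀ᵐ z : Plane, ∃ l, Tendsto (fun j => halfDerivApprox g (κ j) z) atTop (𝓝 l) := by
    filter_upwards [ae_all_iff.2 hball] with z hz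
    obtain ⟨R, hR⟩ := exists_nat_ge ‖z‖
    exact hz R hR
  obtain ⟨v, hv, hvlim⟩ := exists_stronglyMeasurable_limit_of_tendsto_ae
    (fun j => (hcont (κ j)).aestronglyMeasurable) hall
  exact ⟨κ, v, hκ, hv, hvlim⟩

/-- The almost everywhere limit of the truncations pairs with Schwartz functions in the way that
the inverse Fourier transform of `|ξ|^{1/2} g` does. The polynomial weight is what upgrades
convergence in weighted `L²` to convergence in `L¹` against `ψ`. -/
theorem integrable_and_integral_mul_limit {ε : ℝ} (hε : 0 < ε) {g : Plane → ℂ}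
    (hg : LocallyIntegrable g) (hg2 : MemLp g 2)
    (hW : MemLp (fun ζ => (weight phaseS ε (1 / 2) ζ : ℂ) * g ζ) 2)
    {κ : ℕ → ℕ} {v : Plane → ℂ} (hκ : StrictMono κ)
    (hlim : ∀ᵐ z, Tendsto (fun j => halfDerivApprox g (κ j) z) atTop (𝓝 (v z)))
    (hv : StronglyMeasurable v) (ψ : 𝓢(Plane, ℂ)) :
    Integrable (fun z => ψ z * v z) ∧
      ∫ z, ψ z * v z = ∫ ζ, (𝓕⁻ ψ) ζ * ((halfDeriv ζ : ℂ) * g ζ) := by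
  have hcont := fun k => continuous_halfDerivApprox hg k
  obtain ⟨C, hC⟩ := exists_eLpNorm_halfDerivApprox_sub_mul_le hε hg (polyMul ψ)
  set e : ℕ → ℝ≥0∞ := fun k =>
    eLpNorm (tail k fun ζ => (weight phaseS ε (1 / 2) ζ : ℂ) * g ζ) 2 volume with he
  have he0 : Tendsto (fun j => e (κ j)) atTop (𝓝 0) :=
    (tendsto_eLpNorm_tail hW).comp hκ.tendsto_atTop
  set D := eLpNorm (fun z => (polyWeight z)⁻¹) 2 (volume : Measure Plane) with hD
  have hDfin : D < ∞ := memLp_inv_polyWeight.2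
  -- Fatou's lemma, then the Cauchy–Schwarz inequality
  have hL2 : ∀ j, eLpNorm (fun z => (v z - halfDerivApprox g (κ j) z) * polyMul ψ z) 2 volume ≤
      C * e (κ j) := by
    intro j
    refine (Lp.eLpNorm_lim_le_liminf_eLpNorm
      (f := fun i z => (halfDerivApprox g (κ i) z - halfDerivApprox g (κ j) z) * polyMul ψ z)
      (fun i => (((hcont _).sub (hcont _)).mul (polyMul ψ).continuous).aestronglyMeasurable) _
      ?_).trans ?_
    · filter_upwards [hlim] with z hz
      exact (hz.sub_const _).mul_const _
    · refine liminf_le_of_frequently_le' (Eventually.frequently ?_)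
      filter_upwards [eventually_ge_atTop j] with i hi
      exact hC _ _ (hκ.monotone hi)
  have hm : ∀ j, AEStronglyMeasurable
      (fun z => (v z - halfDerivApprox g (κ j) z) * polyMul ψ z) volume := fun j =>
    (hv.aestronglyMeasurable.sub (hcont _).aestronglyMeasurable).mul
      (polyMul ψ).continuous.aestronglyMeasurable
  have hL1 : ∀ j, eLpNorm (fun z => ψ z * v z - ψ z * halfDerivApprox g (κ j) z) 1 volume ≤
      D * (C * e (κ j)) := by
    intro j
    have h := eLpNorm_smul_le_mul_eLpNorm (p := 2) (q := 2) (r := 1) (hm j)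
      memLp_inv_polyWeight.1
    refine le_trans (le_of_eq ?_) (h.trans (mul_le_mul' le_rfl (hL2 j)))
    congr 1
    ext z
    simp only [Pi.smul_apply', smul_eq_mul, polyMul_apply]
    have := polyWeight_ne_zero z
    field_simp
  have hto0 : Tendsto (fun j => D * (C * e (κ j))) atTop (𝓝 0) := by
    have h1 := ENNReal.Tendsto.const_mul he0 (.inr (ENNReal.coe_ne_top (r := C)))
    have h2 := ENNReal.Tendsto.const_mul h1 (.inr hDfin.ne)
    simpa using h2
  have happ : ∀ j, Integrable fun z => ψ z * halfDerivApprox g (κ j) z := fun j =>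
    ψ.integrable.mul_bdd (hcont _).aestronglyMeasurable
      (.of_forall fun z => norm_fourierInv_le _ z)
  have hint : Integrable fun z => ψ z * v z := by
    obtain ⟨j, hj⟩ := (hto0.eventually (gt_mem_nhds ENNReal.zero_lt_top)).exists
    have hd : Integrable fun z => ψ z * v z - ψ z * halfDerivApprox g (κ j) z := by
      rw [← memLp_one_iff_integrable]
      exact ⟨(ψ.continuous.aestronglyMeasurable.mul hv.aestronglyMeasurable).sub
        (happ j).aestronglyMeasurable, (hL1 j).trans_lt hj⟩
    refine (hd.add (happ j)).congr (.of_forall fun z => ?_)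
    simp
  refine ⟨hint, ?_⟩
  have hlim1 : Tendsto (fun j => ∫ z, ψ z * halfDerivApprox g (κ j) z) atTop
      (𝓝 (∫ z, ψ z * v z)) := by
    refine tendsto_integral_of_L1' _ hint.aestronglyMeasurable (.of_forall happ) ?_
    refine tendsto_of_tendsto_of_tendsto_of_le_of_le tendsto_const_nhds hto0 (fun _ => zero_le)
      fun j => ?_
    simp only
    rw [eLpNorm_sub_comm]
    exact hL1 j
  have hlim2 : Tendsto (fun j => ∫ z, ψ z * halfDerivApprox g (κ j) z) atTop
      (𝓝 (∫ ζ, (𝓕⁻ ψ) ζ * ((halfDeriv ζ : ℂ) * g ζ))) := by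
    have hi := integrable_schwartz_mul_halfDeriv_mul hg2 (𝓕⁻ ψ)
    simp only [halfDerivApprox, integral_mul_fourierInv (integrable_halfDeriv_mul_trunc hg _)]
    refine tendsto_integral_of_dominated_convergence _ (fun j => ?_) hi.norm
      (fun j => .of_forall fun ζ => ?_) (.of_forall fun ζ => ?_)
    · exact (𝓕⁻ ψ).continuous.aestronglyMeasurable.mul
        (integrable_halfDeriv_mul_trunc hg _).aestronglyMeasurable
    · rw [norm_mul, norm_mul, norm_mul, norm_mul]
      gcongr
      exact norm_trunc_le _ _ _
    · exact (((tendsto_trunc g ζ).comp hκ.tendsto_atTop).const_mul _).const_mul _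
  exact tendsto_nhds_unique hlim1 hlim2

/-! ### The second factor -/

/-- If the Fourier transform of `n` is a square-integrable function `h`, then `n` is the
`L²` inverse Fourier transform of `h`. -/
theorem isFunction_fourierInv_toLp {n : 𝓢'(Plane, ℂ)} {h : Plane → ℂ} (hn : IsFunction (𝓕 n) h)
    (h2 : MemLp h 2) :
    IsFunction n (𝓕⁻ (h2.toLp h) : Lp ℂ 2 (volume : Measure Plane)) := by
  have hF : 𝓕 n = (h2.toLp h : 𝓢'(Plane, ℂ)) := by
    ext ψ
    rw [(hn.2 ψ).2, Lp.toTemperedDistribution_apply]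
    refine integral_congr_ae ?_
    filter_upwards [h2.coeFn_toLp] with ζ hζ
    rw [hζ, smul_eq_mul]
  have hn' : n = ((𝓕⁻ (h2.toLp h) : Lp ℂ 2 (volume : Measure Plane)) : 𝓢'(Plane, ℂ)) := by
    rw [← Lp.fourierInv_toTemperedDistribution_eq, ← hF, FourierTransform.fourierInv_fourier_eq]
  have := isFunction_toTemperedDistribution (𝓕⁻ (h2.toLp h))
  rwa [← hn'] at this

theorem tendsto_eLpNorm_fourierInv_trunc_sub {h : Plane → ℂ} (hl : LocallyIntegrable h)
    (h2 : MemLp h 2) :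
    Tendsto (fun k => eLpNorm (𝓕⁻ (trunc k h) -
      ((𝓕⁻ (h2.toLp h) : Lp ℂ 2 (volume : Measure Plane)) : Plane → ℂ)) 2 volume) atTop (𝓝 0) := by
  refine (tendsto_eLpNorm_tail h2).congr fun k => ?_
  have hk2 : MemLp (trunc k h) 2 := h2.indicator Metric.isClosed_closedBall.measurableSet
  have hsub : (𝓕⁻ (hk2.toLp _ - h2.toLp h) : Lp ℂ 2 (volume : Measure Plane)) =
      𝓕⁻ (hk2.toLp _) - 𝓕⁻ (h2.toLp h) :=
    (Lp.fourierTransformₗᵢ Plane ℂ).symm.map_sub _ _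
  calc eLpNorm (tail k h) 2 volume
      = eLpNorm ((hk2.toLp _ - h2.toLp h : Lp ℂ 2 (volume : Measure Plane))) 2 volume := by
        rw [← eLpNorm_neg, ← trunc_sub_self]
        refine eLpNorm_congr_ae ?_
        filter_upwards [Lp.coeFn_sub (hk2.toLp _) (h2.toLp h), hk2.coeFn_toLp, h2.coeFn_toLp]
          with ζ a b c
        rw [a, Pi.sub_apply, Pi.sub_apply, b, c]
    _ = _ := by
        rw [← eLpNorm_fourierInv_Lp, hsub]
        refine eLpNorm_congr_ae ?_
        filter_upwards [Lp.coeFn_sub (𝓕⁻ (hk2.toLp _)) (𝓕⁻ (h2.toLp h)),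
          fourierInv_toLp_ae_eq (integrable_trunc hl k) hk2] with ζ a b
        rw [a, Pi.sub_apply, Pi.sub_apply, b]

end Zakharov

open Zakharov

theorem lemma2p3 (ε : ℝ) (hε : 0 < ε) :
    ∃ c : ℝ≥0, ∀ (σ : ℤˣ) (u n : 𝓢'(Zakharov.Plane, ℂ)),
      Zakharov.MemX Zakharov.phaseS ε (1 / 2) u →
      Zakharov.MemX (Zakharov.phaseW σ) 0 (1 / 2) n →
      ∃ (w : 𝓢'(Zakharov.Plane, ℂ)) (v N : Zakharov.Plane → ℂ),
        Zakharov.IsDx (1 / 2) u w ∧ Zakharov.IsFunction w v ∧ Zakharov.IsFunction n N ∧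
        MemLp (fun z => v z * N z) 2 volume ∧
        eLpNorm (fun z => v z * N z) 2 volume ≤
          c * Zakharov.xNorm (Zakharov.phaseW σ) 0 (1 / 2) n *
            Zakharov.xNorm Zakharov.phaseS ε (1 / 2) u := by
  obtain ⟨C, hC⟩ := exists_eLpNorm_fourierInv_mul_le hε
  refine ⟨C, fun σ u n hu hn => ?_⟩
  obtain ⟨g, hg⟩ := exists_isFunction_of_xNorm_lt_top hu.1
  obtain ⟨h, hh⟩ := exists_isFunction_of_xNorm_lt_top hn.1
  have hun := hu.1
  have hnn := hn.1
  rw [xNorm_eq hg] at hun ⊢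
  rw [xNorm_eq hh] at hnn ⊢
  have hg2 : MemLp g 2 := memLp_of_weight_mul hε.le (by norm_num) hg.1 hun
  have hh2 : MemLp h 2 := memLp_of_weight_mul le_rfl (by norm_num) hh.1 hnn
  have hgl := hg.locallyIntegrable
  have hhl := hh.locallyIntegrable
  have hW : MemLp (fun ζ => (weight phaseS ε (1 / 2) ζ : ℂ) * g ζ) 2 :=
    ⟨(Complex.measurable_ofReal.comp
      (measurable_weight measurable_phaseS _ _)).aestronglyMeasurable.mul hg.1, hun⟩
  obtain ⟨κ, v, hκ, hv, hvlim⟩ := exists_ae_tendsto_halfDerivApprox hε hgl hW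
  obtain ⟨w, hw⟩ := exists_fourier_isFunction_halfDeriv_mul hg2
  set N : Plane → ℂ := ((𝓕⁻ (hh2.toLp h) : Lp ℂ 2 (volume : Measure Plane)) : Plane → ℂ)
  have hNm : AEStronglyMeasurable N volume := Lp.aestronglyMeasurable _
  have hwv : IsFunction w v := by
    refine ⟨hv.aestronglyMeasurable, fun ψ => ?_⟩
    obtain ⟨h1, h2⟩ := integrable_and_integral_mul_limit hε hgl hg2 hW hκ hvlim hv ψ
    refine ⟨h1, ?_⟩
    rw [h2, ← (hw.2 (𝓕⁻ ψ)).2, TemperedDistribution.fourier_apply,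
      FourierTransform.fourier_fourierInv_eq]
  -- a further subsequence along which the approximations of `n` converge almost everywhere
  obtain ⟨ν, hν, hνlim⟩ := (tendstoInMeasure_of_tendsto_eLpNorm (by norm_num)
    (fun j => (continuous_fourierInv (integrable_trunc hhl (κ j))).aestronglyMeasurable) hNm
    ((tendsto_eLpNorm_fourierInv_trunc_sub hhl hh2).comp hκ.tendsto_atTop)).exists_seq_tendsto_ae
  have hbound : eLpNorm (fun z => v z * N z) 2 volume ≤
      C * eLpNorm (fun ζ => (weight (phaseW σ) 0 (1 / 2) ζ : ℂ) * h ζ) 2 volume *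
        eLpNorm (fun ζ => (weight phaseS ε (1 / 2) ζ : ℂ) * g ζ) 2 volume := by
    refine (Lp.eLpNorm_lim_le_liminf_eLpNorm
      (f := fun j z => halfDerivApprox g (κ (ν j)) z * 𝓕⁻ (trunc (κ (ν j)) h) z)
      (fun j => ((continuous_halfDerivApprox hgl _).mul
        (continuous_fourierInv (integrable_trunc hhl _))).aestronglyMeasurable) _ ?_).trans ?_
    · filter_upwards [hvlim, hνlim] with z h1 h2
      exact (h1.comp hν.tendsto_atTop).mul h2
    · refine liminf_le_of_frequently_le' (Frequently.of_forall fun j => ?_)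
      refine (hC σ (trunc (κ (ν j)) g) (trunc (κ (ν j)) h) (aestronglyMeasurable_trunc hg.1 _)
        (integrable_halfDeriv_mul_trunc hgl _) (integrable_trunc hhl _)).trans ?_
      refine mul_le_mul' (mul_le_mul' le_rfl (eLpNorm_mono fun ζ => ?_))
        (eLpNorm_mono fun ζ => ?_)
      · rw [norm_mul, norm_mul]; gcongr; exact norm_trunc_le _ _ _
      · rw [norm_mul, norm_mul]; gcongr; exact norm_trunc_le _ _ _
  refine ⟨w, v, N, ⟨g, hg, hw⟩, hwv, isFunction_fourierInv_toLp hh hh2, ⟨?_, ?_⟩, hbound⟩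
  · exact hv.aestronglyMeasurable.mul hNm
  · exact hbound.trans_lt (ENNReal.mul_lt_top (ENNReal.mul_lt_top ENNReal.coe_lt_top hnn) hun)
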